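/- Let $\mathcal{E}$ and $\mathcal{E}'$ be separable complex Hilbert spaces. For a contraction $A$ between Hilbert spaces let $D_A=(I-A^*A)^{1/2}$ be its defect operator and $\mathcal{D}_A$ the closure of the range of $D_A$. For contractions $A,B$ between the same two Hilbert spaces, $B$ is Shmul'yan dominated by $A$ if $B=A+D_{A^*}XD_A$ for some bounded operator $X:\mathcal{D}_A\to\mathcal{D}_{A^*}$. Let $H_1^\infty(\mathcal{E},\mathcal{E}')$ (the Schur class) be the set of analytic functions $F$ on the open unit disc $\mathbb{D}$ with values in the bounded operators $\mathcal{E}\to\mathcal{E}'$ such that $\|F\|_\infty=\sup_{\lambda\in\mathbb{D}}\|F(\lambda)\|\le 1$. For such $F$ let $T_F:H^2(\mathcal{E})\to H^2(\mathcal{E}')$ be the contraction between vector-valued Hardy spaces of the disc given by $(T_Fg)(\lambda)=F(\lambda)g(\lambda)$. For $F,G\in H_1^\infty(\mathcal{E},\mathcal{E}')$, $F$ is Shmul'yan–ter Horst dominated by $G$ if $T_F$ is Shmul'yan dominated by $T_G$; let $\Delta_\infty(F)$ be the set of all $G\in H_1^\infty(\mathcal{E},\mathcal{E}')$ such that each of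 $F$ and $G$ is Shmul'yan–ter Horst dominated by the other. Theorem. Let $T:\mathcal{E}\to\mathcal{E}'$ be a partial isometry, that is, a bounded operator with $TT^*T=T$, viewed as a constant function in $H_1^\infty(\mathcal{E},\mathcal{E}')$. Then $$\Delta_\infty(T)=\{F\in H_1^\infty(\mathcal{E},\mathcal{E}') : F(\lambda)=T+D_{T^*}F_0(\lambda)D_T \text{ for all } \lambda\in\mathbb{D}, \text{ for some } F_0\in H_1^\infty(\mathcal{D}_T,\mathcal{D}_{T^*}) \text{ with } \|F_0\|_\infty<1\}.$$ -/

import Mathlib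

noncomputable section

namespace ShmulyanTerHorst

open ContinuousLinearMap
open scoped Complex.UnitDisc ENNReal InnerProductSpace

section Operators

variable {H₁ H₂ : Type*}
  [NormedAddCommGroup H₁] [InnerProductSpace ℂ H₁] [CompleteSpace H₁]
  [NormedAddCommGroup H₂] [InnerProductSpace ℂ H₂] [CompleteSpace H₂]

/-- `T` is a partial isometry: `T T* T = T`. -/
def IsPartialIsometry (T : H₁ →L[ℂ] H₂) : Prop :=
  T ∘L adjoint T ∘L T = T

/-- The defect operator `D_T = (I - T* T)^{1/2}` of a contraction `T`. -/
def defect (T : H₁ →L[ℂ] H₂) : H₁ →L[ℂ] H₁ :=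
  CFC.sqrt (1 - adjoint T ∘L T)

/-- The defect space `𝒟_T`, the closure of the range of `D_T`. -/
abbrev defectSpace (T : H₁ →L[ℂ] H₂) : Submodule ℂ H₁ :=
  (LinearMap.range (defect T).toLinearMap).topologicalClosure

/-- The defect operator `D_T` viewed as an operator from the whole space into `𝒟_T`. -/
def defectInto (T : H₁ →L[ℂ] H₂) : H₁ →L[ℂ] defectSpace T :=
  (defect T).codRestrict (defectSpace T) fun x =>
    Submodule.le_topologicalClosure _ (LinearMap.mem_range_self _ x)

/-- The defect operator `D_T` viewed as an operator from `𝒟_T` into the whole space. -/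
def defectFrom (T : H₁ →L[ℂ] H₂) : defectSpace T →L[ℂ] H₁ :=
  defect T ∘L (defectSpace T).subtypeL

/-- The operator `A + D_{A*} X D_A`, for `X : 𝒟_A → 𝒟_{A*}`. -/
def defectPerturbation (A : H₁ →L[ℂ] H₂)
    (X : defectSpace A →L[ℂ] defectSpace (adjoint A)) : H₁ →L[ℂ] H₂ :=
  A + defectFrom (adjoint A) ∘L X ∘L defectInto A

/-- `B` is Shmul'yan dominated by `A` (for contractions `A`, `B`):
`B = A + D_{A*} X D_A` for some bounded `X : 𝒟_A → 𝒟_{A*}`. -/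
def ShmulyanDominatedBy (B A : H₁ →L[ℂ] H₂) : Prop :=
  ∃ X : defectSpace A →L[ℂ] defectSpace (adjoint A), B = defectPerturbation A X

theorem IsPartialIsometry.norm_le_one {T : H₁ →L[ℂ] H₂} (hT : IsPartialIsometry T) :
    ‖T‖ ≤ 1 := by
  have h1 : ‖adjoint T ∘L T‖ = ‖T‖ * ‖T‖ := norm_adjoint_comp_self T
  have h2 : ‖T‖ ≤ ‖T‖ * (‖T‖ * ‖T‖) := by
    calc ‖T‖ = ‖T ∘L (adjoint T ∘L T)‖ := by rw [hT]
      _ ≤ ‖T‖ * ‖adjoint T ∘L T‖ := opNorm_comp_le _ _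
      _ = _ := by rw [h1]
  have h3 : ‖adjoint T ∘L T‖ = (‖T‖ * ‖T‖) * (‖T‖ * ‖T‖) := by
    have h4 : adjoint (adjoint T ∘L T) ∘L (adjoint T ∘L T) = adjoint T ∘L T := by
      rw [adjoint_comp, adjoint_adjoint, comp_assoc, hT]
    rw [← h1, ← norm_adjoint_comp_self (adjoint T ∘L T), h4]
  rw [h1] at h3
  by_contra hc
  push Not at hc
  nlinarith [mul_pos (sub_pos.2 hc) (sub_pos.2 hc), norm_nonneg T]

end Operators

section Analytic

variable {V W : Type*} [NormedAddCommGroup V] [NormedSpace ℂ V]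
  [NormedAddCommGroup W] [NormedSpace ℂ W]

/-- A function on the open unit disc is analytic if it is the restriction to the disc of a function
that is complex differentiable at the points of the disc. -/
def AnalyticOnDisc (F : 𝔻 → V) : Prop :=
  ∃ f : ℂ → V, DifferentiableOn ℂ f (Metric.ball 0 1) ∧ ∀ z : 𝔻, F z = f z

/-- Membership in `H^∞(V, W)`: norm bounded analytic functions on the disc with values in the
bounded operators from `V` to `W`. -/
def IsHInfinity (F : 𝔻 → (V →L[ℂ] W)) : Prop :=
  AnalyticOnDisc F ∧ BddAbove (Set.range fun z => ‖F z‖)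

/-- The norm `‖F‖_∞` of `H^∞(V, W)`, the supremum of `‖F z‖` over the disc. -/
def hInfinityNorm (F : 𝔻 → (V →L[ℂ] W)) : ℝ :=
  ⨆ z : 𝔻, ‖F z‖

variable (V W) in
/-- The Schur class `H_1^∞(V, W)`, the closed unit ball of `H^∞(V, W)`. -/
def SchurClass : Type _ :=
  {F : 𝔻 → (V →L[ℂ] W) // IsHInfinity F ∧ hInfinityNorm F ≤ 1}

theorem SchurClass.norm_apply_le (F : SchurClass V W) (z : 𝔻) : ‖F.1 z‖ ≤ 1 :=
  (le_ciSup F.2.1.2 z).trans F.2.2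

/-- A contraction viewed as a constant function in the Schur class. -/
def SchurClass.const (T : V →L[ℂ] W) (hT : ‖T‖ ≤ 1) : SchurClass V W :=
  ⟨fun _ => T,
    ⟨⟨fun _ => T, differentiableOn_const _, fun _ => rfl⟩,
      ⟨1, by rintro _ ⟨z, rfl⟩; exact hT⟩⟩,
    ciSup_le fun _ => hT⟩

end Analytic

section Hardy

/-- The Hardy space `H²(E)` of the disc: the function with Taylor coefficients `a₀, a₁, …` is
represented by the square summable sequence of its coefficients, with `‖g‖² = ∑ ‖aₙ‖²`. Its values
on the disc are given by `HardyTwo.eval`. -/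
abbrev HardyTwo (E : Type*) [NormedAddCommGroup E] : Type _ :=
  lp (fun _ : ℕ => E) 2

variable {E E' : Type*} [NormedAddCommGroup E] [InnerProductSpace ℂ E]
  [NormedAddCommGroup E'] [InnerProductSpace ℂ E']

/-- The value `g(z) = ∑ zⁿ aₙ` of a function of the Hardy space at a point of the disc. -/
def HardyTwo.eval (g : HardyTwo E) (z : 𝔻) : E :=
  ∑' n : ℕ, (z : ℂ) ^ n • g n

theorem summable_norm_pow {a : ℕ → E} {C : ℝ} (ha : ∀ n, ‖a n‖ ≤ C) {z : ℂ} (hz : ‖z‖ < 1) :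
    Summable fun n => ‖z ^ n • a n‖ := by
  refine Summable.of_nonneg_of_le (fun _ => norm_nonneg _) (fun n => ?_)
    ((summable_geometric_of_lt_one (norm_nonneg z) hz).mul_right C)
  rw [norm_smul, norm_pow]
  gcongr
  exact ha n

theorem coeff_le {E : Type*} [NormedAddCommGroup E] (g : HardyTwo E) (n : ℕ) : ‖g n‖ ≤ ‖g‖ :=
  lp.norm_apply_le_norm two_ne_zero g n

theorem integral_exp (m : ℤ) :
    ∫ t in (0 : ℝ)..2 * Real.pi, Complex.exp (m * Complex.I * t) =
      if m = 0 then (2 * Real.pi : ℂ) else 0 := by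
  split_ifs with h
  · simp [h]
  · have hc : (m * Complex.I : ℂ) ≠ 0 := by simp [h]
    rw [integral_exp_mul_complex hc]
    have : Complex.exp (m * Complex.I * ((2 * Real.pi : ℝ) : ℂ)) = 1 := by
      rw [Complex.exp_eq_one_iff]
      exact ⟨m, by push_cast; ring⟩
    rw [this]
    simp

/-- Parseval's identity on the circle for absolutely convergent series. -/
theorem parseval [CompleteSpace E] {a : ℕ → E} (ha : Summable fun n => ‖a n‖) :
    HasSum (fun n => 2 * Real.pi * ‖a n‖ ^ 2)
      (∫ t in (0 : ℝ)..2 * Real.pi,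
        ‖∑' n : ℕ, Complex.exp (Complex.I * t) ^ n • a n‖ ^ 2) := by
  set e : ℕ → ℝ → ℂ := fun n t => Complex.exp (Complex.I * t) ^ n with he
  set h : ℝ → E := fun t => ∑' n : ℕ, e n t • a n with hh
  have hen : ∀ n t, ‖e n t‖ = 1 := by
    intro n t
    simp [he, mul_comm Complex.I]
  have hec : ∀ n, Continuous (e n) := fun n => by fun_prop
  have hterm : ∀ n t, ‖e n t • a n‖ = ‖a n‖ := fun n t => by rw [norm_smul, hen, one_mul]
  have hs : ∀ t, HasSum (fun n => e n t • a n) (h t) := fun t =>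
    (Summable.of_norm (by simpa only [hterm] using ha)).hasSum
  have hcont : Continuous h :=
    continuous_tsum (fun n => (hec n).smul continuous_const) ha fun n t => (hterm n t).le
  have hbd : ∀ t, ‖h t‖ ≤ ∑' n, ‖a n‖ := fun t =>
    tsum_of_norm_bounded ha.hasSum fun n => (hterm n t).le
  have hee : ∀ k n t, (starRingEnd ℂ) (e k t) * e n t =
      Complex.exp (((n : ℤ) - (k : ℤ) : ℤ) * Complex.I * t) := by
    intro k n t
    simp only [he, ← Complex.exp_nat_mul, ← Complex.exp_conj, ← Complex.exp_add]
    congr 1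
    simp
    ring
  -- the Fourier coefficients of `h`
  have hfour : ∀ k (y : E), ∫ t in (0 : ℝ)..2 * Real.pi, ⟪e k t • y, h t⟫_ℂ =
      2 * Real.pi * ⟪y, a k⟫_ℂ := by
    intro k y
    have h1 : HasSum (fun n => ∫ t in (0 : ℝ)..2 * Real.pi, ⟪e k t • y, e n t • a n⟫_ℂ)
        (∫ t in (0 : ℝ)..2 * Real.pi, ⟪e k t • y, h t⟫_ℂ) := by
      refine intervalIntegral.hasSum_integral_of_dominated_convergence
        (fun n _ => ‖y‖ * ‖a n‖) (fun n => ?_) (fun n => ?_) ?_ ?_ ?_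
      · exact Continuous.aestronglyMeasurable
          (((hec k).smul continuous_const).inner ((hec n).smul continuous_const))
      · refine Filter.Eventually.of_forall fun t _ => ?_
        refine (norm_inner_le_norm _ _).trans ?_
        rw [hterm, norm_smul, hen, one_mul]
      · exact Filter.Eventually.of_forall fun t _ => ha.mul_left _
      · exact intervalIntegrable_const
      · exact Filter.Eventually.of_forall fun t _ => (hs t).mapL (innerSL ℂ (e k t • y))
    have h2 : ∀ n, ∫ t in (0 : ℝ)..2 * Real.pi, ⟪e k t • y, e n t • a n⟫_ℂ =
        if n = k then 2 * Real.pi * ⟪y, a k⟫_ℂ else 0 := by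
      intro n
      have h3 : ∀ t : ℝ, ⟪e k t • y, e n t • a n⟫_ℂ =
          Complex.exp (((n : ℤ) - (k : ℤ) : ℤ) * Complex.I * t) * ⟪y, a n⟫_ℂ := by
        intro t
        rw [inner_smul_left, inner_smul_right, ← mul_assoc, hee]
      simp only [h3]
      rw [intervalIntegral.integral_mul_const, integral_exp]
      by_cases hnk : n = k
      · subst hnk; simp
      · have : ((n : ℤ) - (k : ℤ)) ≠ 0 := by omega
        simp [hnk, this]
    simp only [h2] at h1
    exact h1.unique (hasSum_ite_eq k _)
  have key : HasSum (fun k => ∫ t in (0 : ℝ)..2 * Real.pi, ⟪e k t • a k, h t⟫_ℂ)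
      (∫ t in (0 : ℝ)..2 * Real.pi, ⟪h t, h t⟫_ℂ) := by
    refine intervalIntegral.hasSum_integral_of_dominated_convergence
      (fun n _ => ‖a n‖ * ∑' n, ‖a n‖) (fun n => ?_) (fun n => ?_) ?_ ?_ ?_
    · exact Continuous.aestronglyMeasurable (((hec n).smul continuous_const).inner hcont)
    · refine Filter.Eventually.of_forall fun t _ => ?_
      refine (norm_inner_le_norm _ _).trans ?_
      rw [hterm]
      gcongr
      exact hbd t
    · exact Filter.Eventually.of_forall fun t _ => ha.mul_right _
    · exact intervalIntegrable_const
    · refine Filter.Eventually.of_forall fun t _ => ?_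
      have h5 := ((hs t).mapL (innerSL ℂ (h t))).star
      simpa [innerSL_apply_apply, mul_comm] using h5
  simp only [hfour] at key
  have h6 : (∫ t in (0 : ℝ)..2 * Real.pi, ⟪h t, h t⟫_ℂ) =
      ((∫ t in (0 : ℝ)..2 * Real.pi, ‖h t‖ ^ 2 : ℝ) : ℂ) := by
    rw [← intervalIntegral.integral_ofReal]
    congr 1
    ext t
    rw [inner_self_eq_norm_sq_to_K]
    push_cast
    rfl
  rw [h6] at key
  have h7 : ∀ k, (2 * Real.pi * ⟪a k, a k⟫_ℂ : ℂ) = ((2 * Real.pi * ‖a k‖ ^ 2 : ℝ) : ℂ) := by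
    intro k
    rw [inner_self_eq_norm_sq_to_K]
    push_cast
    rfl
  simp only [h7] at key
  exact_mod_cast key

/-- If `‖∑ zⁿ bₙ‖ ≤ ‖∑ zⁿ gₙ‖` on the disc, then `∑ ‖bₙ‖² ≤ ∑ ‖gₙ‖²`. -/
theorem sum_coeff_sq_le [CompleteSpace E] [CompleteSpace E'] (g : HardyTwo E) (b : ℕ → E')
    (hb : ∀ z : ℂ, ‖z‖ < 1 → Summable fun n => ‖z ^ n • b n‖)
    (hle : ∀ z : ℂ, ‖z‖ < 1 → ‖∑' n, z ^ n • b n‖ ≤ ‖∑' n, z ^ n • g n‖) (s : Finset ℕ) :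
    ∑ n ∈ s, ‖b n‖ ^ 2 ≤ ‖g‖ ^ 2 := by
  have hg2 : HasSum (fun n => ‖g n‖ ^ 2) (‖g‖ ^ 2) := by
    have h := lp.hasSum_norm (p := 2) (by norm_num) g
    simpa using h
  have hr : ∀ r : ℝ, 0 < r → r < 1 → ∑ n ∈ s, ‖((r : ℂ) ^ n) • b n‖ ^ 2 ≤ ‖g‖ ^ 2 := by
    intro r hr0 hr1
    have hrn : ‖(r : ℂ)‖ < 1 := by simpa [abs_of_pos hr0] using hr1
    have hgs := summable_norm_pow (coeff_le g) hrn
    have pb := parseval (hb r hrn)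
    have pg := parseval hgs
    have hz : ∀ t : ℝ, ‖Complex.exp (Complex.I * t) * r‖ < 1 := by
      intro t
      rw [norm_mul, mul_comm Complex.I, Complex.norm_exp_ofReal_mul_I, one_mul]
      exact hrn
    have hsm : ∀ (t : ℝ) (n : ℕ) (x : E),
        Complex.exp (Complex.I * t) ^ n • ((r : ℂ) ^ n • x) =
          (Complex.exp (Complex.I * t) * r) ^ n • x := by
      intro t n x
      rw [smul_smul, mul_pow]
    have hsm' : ∀ (t : ℝ) (n : ℕ) (x : E'),
        Complex.exp (Complex.I * t) ^ n • ((r : ℂ) ^ n • x) =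
          (Complex.exp (Complex.I * t) * r) ^ n • x := by
      intro t n x
      rw [smul_smul, mul_pow]
    have hcb : Continuous fun t : ℝ =>
        ∑' n : ℕ, Complex.exp (Complex.I * t) ^ n • ((r : ℂ) ^ n • b n) := by
      refine continuous_tsum (fun n => by fun_prop) (hb r hrn) fun n t => ?_
      rw [norm_smul, norm_pow, mul_comm Complex.I, Complex.norm_exp_ofReal_mul_I, one_pow, one_mul]
    have hcg : Continuous fun t : ℝ =>
        ∑' n : ℕ, Complex.exp (Complex.I * t) ^ n • ((r : ℂ) ^ n • g n) := by
      refine continuous_tsum (fun n => by fun_prop) hgs fun n t => ?_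
      rw [norm_smul, norm_pow, mul_comm Complex.I, Complex.norm_exp_ofReal_mul_I, one_pow, one_mul]
    have hint : (∫ t in (0 : ℝ)..2 * Real.pi,
          ‖∑' n : ℕ, Complex.exp (Complex.I * t) ^ n • ((r : ℂ) ^ n • b n)‖ ^ 2) ≤
        ∫ t in (0 : ℝ)..2 * Real.pi,
          ‖∑' n : ℕ, Complex.exp (Complex.I * t) ^ n • ((r : ℂ) ^ n • g n)‖ ^ 2 := by
      refine intervalIntegral.integral_mono_on Real.two_pi_pos.le
        ((hcb.norm.pow 2).intervalIntegrable _ _) ((hcg.norm.pow 2).intervalIntegrable _ _)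
        fun t _ => ?_
      simp only [hsm, hsm']
      gcongr
      exact hle _ (hz t)
    have h1 : ∑ n ∈ s, 2 * Real.pi * ‖((r : ℂ) ^ n) • b n‖ ^ 2 ≤ 2 * Real.pi * ‖g‖ ^ 2 := by
      refine (sum_le_hasSum s (fun n _ => by positivity) pb).trans (hint.trans ?_)
      refine hasSum_le (fun n => ?_) pg (hg2.mul_left (2 * Real.pi))
      have : ‖(r : ℂ) ^ n • g n‖ ≤ ‖g n‖ := by
        rw [norm_smul, norm_pow]
        exact mul_le_of_le_one_left (norm_nonneg _) (pow_le_one₀ (norm_nonneg _) hrn.le)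
      gcongr
    rw [← Finset.mul_sum] at h1
    exact le_of_mul_le_mul_left h1 Real.two_pi_pos
  have hlim : Filter.Tendsto (fun r : ℝ => ∑ n ∈ s, ‖((r : ℂ) ^ n) • b n‖ ^ 2)
      (nhdsWithin 1 (Set.Iio 1)) (nhds (∑ n ∈ s, ‖b n‖ ^ 2)) := by
    have hc : Continuous fun r : ℝ => ∑ n ∈ s, ‖((r : ℂ) ^ n) • b n‖ ^ 2 := by fun_prop
    have := hc.tendsto 1
    simp only [Complex.ofReal_one, one_pow, one_smul] at this
    exact this.mono_left nhdsWithin_le_nhds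
  refine le_of_tendsto hlim ?_
  filter_upwards [Ioo_mem_nhdsLT (show (0 : ℝ) < 1 by norm_num)] with r hr'
  exact hr r hr'.1 hr'.2

/-- The values on the disc determine a function of the Hardy space. -/
theorem HardyTwo.eval_injective [CompleteSpace E] {g h : HardyTwo E}
    (H : ∀ z, g.eval z = h.eval z) : g = h := by
  have hz : ∀ z : ℂ, ‖z‖ < 1 → ∑' n, z ^ n • (g - h) n = 0 := by
    intro z hz
    have h1 := (summable_norm_pow (coeff_le g) hz).of_norm
    have h2 := (summable_norm_pow (coeff_le h) hz).of_norm
    have h3 : g.eval (.mk z hz) = h.eval (.mk z hz) := H _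
    simp only [HardyTwo.eval, Complex.UnitDisc.coe_mk] at h3
    have h4 : ∀ n, z ^ n • (g - h) n = z ^ n • g n - z ^ n • h n := fun n => by
      rw [lp.coeFn_sub, Pi.sub_apply, smul_sub]
    simp only [h4]
    rw [h1.tsum_sub h2, h3, sub_self]
  have key : ∀ n, (g - h) n = 0 := by
    intro n
    have := sum_coeff_sq_le (0 : HardyTwo E) (fun n => (g - h) n)
      (fun z hz => summable_norm_pow (coeff_le (g - h)) hz)
      (fun z hz' => by rw [hz z hz']; simp) {n}
    simpa using this
  rw [← sub_eq_zero]
  ext n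
  exact key n

theorem hardy_differentiableOn [CompleteSpace E] (g : HardyTwo E) :
    DifferentiableOn ℂ (fun z : ℂ => ∑' n, z ^ n • g n) (Metric.ball 0 1) := by
  intro z hz
  obtain ⟨r, hzr, hr1⟩ := exists_between (mem_ball_zero_iff.1 hz)
  have hr0 : 0 ≤ r := (norm_nonneg z).trans hzr.le
  have hd : DifferentiableOn ℂ (fun z : ℂ => ∑' n, z ^ n • g n) (Metric.ball 0 r) := by
    refine Complex.differentiableOn_tsum_of_summable_norm (u := fun n => r ^ n * ‖g‖)
      ((summable_geometric_of_lt_one hr0 hr1).mul_right _)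
      (fun n => (DifferentiableOn.pow differentiableOn_id n).smul_const _) Metric.isOpen_ball
      fun n w hw => ?_
    rw [norm_smul, norm_pow]
    have hw' := mem_ball_zero_iff.1 hw
    gcongr
    exact coeff_le g n
  exact (hd.differentiableAt (Metric.isOpen_ball.mem_nhds
    (mem_ball_zero_iff.2 hzr))).differentiableWithinAt

theorem exists_taylor_coeff [CompleteSpace E] {f : ℂ → E}
    (hf : DifferentiableOn ℂ f (Metric.ball 0 1)) :
    ∃ c : ℕ → E, ∀ z : ℂ, ‖z‖ < 1 →
      (Summable fun n => ‖z ^ n • c n‖) ∧ ∑' n, z ^ n • c n = f z := by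
  set c : ℕ → E := fun n => ((n.factorial : ℂ))⁻¹ • iteratedDeriv n f 0 with hc
  have hsum : ∀ z : ℂ, ‖z‖ < 1 → HasSum (fun n => z ^ n • c n) (f z) := by
    intro z hz
    have h := Complex.hasSum_taylorSeries_on_ball hf (mem_ball_zero_iff.2 hz)
    simp only [sub_zero] at h
    convert h using 2 with n
    rw [hc, smul_comm]
  refine ⟨c, fun z hz => ⟨?_, (hsum z hz).tsum_eq⟩⟩
  obtain ⟨r, hzr, hr1⟩ := exists_between hz
  have hr0 : 0 < r := (norm_nonneg z).trans_lt hzr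
  have hrn : ‖(r : ℂ)‖ < 1 := by simpa [abs_of_pos hr0] using hr1
  obtain ⟨C, hC⟩ := (hsum r hrn).summable.tendsto_atTop_zero.norm.bddAbove_range
  have hq : ‖z / r‖ < 1 := by
    rw [norm_div, Complex.norm_real, Real.norm_of_nonneg hr0.le]
    exact (div_lt_one hr0).2 hzr
  have h := summable_norm_pow (a := fun n => (r : ℂ) ^ n • c n) (fun n => hC ⟨n, rfl⟩) hq
  refine h.congr fun n => ?_
  rw [smul_smul, ← mul_pow, div_mul_cancel₀]
  exact_mod_cast hr0.ne'

/-- Multiplication by a function of the Schur class maps `H²(E)` contractively into `H²(E')`. -/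
theorem exists_mul [CompleteSpace E] [CompleteSpace E'] (F : SchurClass E E') (g : HardyTwo E) :
    ∃ h : HardyTwo E', (∀ z, h.eval z = F.1 z (g.eval z)) ∧ ‖h‖ ≤ ‖g‖ := by
  obtain ⟨f, hf, hFf⟩ := F.2.1.1
  obtain ⟨c, hc⟩ := exists_taylor_coeff (hf.clm_apply (hardy_differentiableOn g))
  have hs := sum_coeff_sq_le g c (fun z hz => (hc z hz).1) fun z hz => by
    rw [(hc z hz).2]
    refine le_of_opNorm_le_of_le _ ?_ le_rfl |>.trans_eq (one_mul _)
    have := F.norm_apply_le (.mk z hz)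
    rwa [hFf, Complex.UnitDisc.coe_mk] at this
  have hmem : Memℓp c 2 := memℓp_gen' (C := ‖g‖ ^ 2) fun s => by simpa using hs s
  refine ⟨⟨c, hmem⟩, fun z => ?_, ?_⟩
  · rw [hFf]
    exact (hc z z.norm_lt_one).2
  · refine lp.norm_le_of_forall_sum_le (by norm_num) (norm_nonneg g) fun s => ?_
    simpa using hs s

theorem HardyTwo.eval_add [CompleteSpace E] (g h : HardyTwo E) (z : 𝔻) :
    (g + h).eval z = g.eval z + h.eval z := by
  simp only [HardyTwo.eval, lp.coeFn_add, Pi.add_apply, smul_add]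
  exact (summable_norm_pow (coeff_le g) z.norm_lt_one).of_norm.tsum_add
    (summable_norm_pow (coeff_le h) z.norm_lt_one).of_norm

theorem HardyTwo.eval_smul [CompleteSpace E] (c : ℂ) (g : HardyTwo E) (z : 𝔻) :
    (c • g).eval z = c • g.eval z := by
  simp only [HardyTwo.eval, lp.coeFn_smul, Pi.smul_apply, smul_comm _ c]
  exact (summable_norm_pow (coeff_le g) z.norm_lt_one).of_norm.tsum_const_smul c

/-- The Toeplitz operator `T_F : H²(E) → H²(E')` of a function `F` of the Schur class, which is
multiplication by `F`: `(T_F g)(z) = F(z) g(z)`. -/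
def toeplitz [CompleteSpace E] [CompleteSpace E'] (F : SchurClass E E') :
    HardyTwo E →L[ℂ] HardyTwo E' :=
  LinearMap.mkContinuous
    { toFun := fun g => (exists_mul F g).choose
      map_add' := fun g h => HardyTwo.eval_injective fun z => by
        rw [HardyTwo.eval_add, (exists_mul F _).choose_spec.1, (exists_mul F _).choose_spec.1,
          (exists_mul F _).choose_spec.1, HardyTwo.eval_add, map_add]
      map_smul' := fun c g => HardyTwo.eval_injective fun z => by
        rw [RingHom.id_apply, HardyTwo.eval_smul, (exists_mul F _).choose_spec.1,
          (exists_mul F _).choose_spec.1, HardyTwo.eval_smul, map_smul] }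
    1 fun g => by
      rw [one_mul]
      exact (exists_mul F g).choose_spec.2

/-- The defining property of the Toeplitz operator. -/
theorem toeplitz_eval [CompleteSpace E] [CompleteSpace E'] (F : SchurClass E E')
    (g : HardyTwo E) (z : 𝔻) : (toeplitz F g).eval z = F.1 z (g.eval z) :=
  (exists_mul F g).choose_spec.1 z

theorem norm_toeplitz_le [CompleteSpace E] [CompleteSpace E'] (F : SchurClass E E') :
    ‖toeplitz F‖ ≤ 1 :=
  LinearMap.mkContinuous_norm_le _ zero_le_one _

/-- `F` is Shmul'yan-ter Horst dominated by `G`: the Toeplitz operator `T_F` is Shmul'yan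
dominated by `T_G`. -/
def DominatedBy [CompleteSpace E] [CompleteSpace E'] (F G : SchurClass E E') : Prop :=
  ShmulyanDominatedBy (toeplitz F) (toeplitz G)

/-- The Shmul'yan-ter Horst equivalence class `Δ_∞(F)` in the Schur class. -/
def equivalenceClass [CompleteSpace E] [CompleteSpace E'] (F : SchurClass E E') :
    Set (SchurClass E E') :=
  {G | DominatedBy G F ∧ DominatedBy F G}

end Hardy

end ShmulyanTerHorst

end

noncomputable section

namespace ShmulyanTerHorst

open ContinuousLinearMap
open scoped Complex.UnitDisc ENNReal InnerProductSpace

/-! ### Defect operators and Shmul'yan domination. -/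

section Operators

variable {H₁ H₂ : Type*}
  [NormedAddCommGroup H₁] [InnerProductSpace ℂ H₁] [CompleteSpace H₁]
  [NormedAddCommGroup H₂] [InnerProductSpace ℂ H₂] [CompleteSpace H₂]

/-! For a partial isometry `T`, the defect operators `1 - T*T` and `1 - TT*` are projections onto
`ker T` and `ker T*`. Hence `T` dominates `B` exactly when `T*(B - T) = 0` and `(B - T)T* = 0`. The
Toeplitz operator `T_T` of the constant `T` is again a partial isometry, and these two identities
hold for `T_F`, `T_T` iff they hold for `F(z)`, `T` at every `z`
(`IsPartialIsometry.dominatedBy_const_iff`). So `T` dominates `F` iff `F = T + D_{T*} F₀ D_T`, and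
the reverse domination must be matched with `‖F₀‖_∞ < 1`.

If `F` dominates `T`, then `T_F` is bounded by some `c < 1` on `ker T_T`
(`exists_norm_apply_le_of_dominatedBy`), and testing on Szegő kernels gives `‖F₀(z)‖ ≤ c`
(`norm_apply_le_of_toeplitz`). Conversely, `‖F₀‖_∞ < 1` makes `T_F - T_T` a strict contraction, and
inverting `1 - B*B` and `1 - BB*` for this difference `B` produces the required operator
(`shmulyanDominatedBy_of_norm_sub_lt_one`). -/

theorem one_sub_adjoint_comp_self_apply (A : H₁ →L[ℂ] H₂) (x : H₁) :
    (1 - adjoint A ∘L A) x = x - adjoint A (A x) :=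
  rfl

theorem one_sub_adjoint_comp_self_nonneg {A : H₁ →L[ℂ] H₂} (hA : ‖A‖ ≤ 1) :
    0 ≤ 1 - adjoint A ∘L A := by
  rw [nonneg_iff_isPositive, isPositive_iff_complex]
  intro x
  have h : ⟪(1 - adjoint A ∘L A) x, x⟫_ℂ = ((‖x‖ ^ 2 - ‖A x‖ ^ 2 : ℝ) : ℂ) := by
    rw [one_sub_adjoint_comp_self_apply, inner_sub_left, adjoint_inner_left,
      inner_self_eq_norm_sq_to_K, inner_self_eq_norm_sq_to_K]
    push_cast
    rfl
  rw [h]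
  simp only [RCLike.re_eq_complex_re, Complex.ofReal_re, true_and]
  have h1 : ‖A x‖ ≤ ‖x‖ := (A.le_of_opNorm_le hA x).trans_eq (one_mul _)
  have h2 : ‖A x‖ ^ 2 ≤ ‖x‖ ^ 2 := by gcongr
  exact sub_nonneg.2 h2

theorem defect_comp_defect {A : H₁ →L[ℂ] H₂} (hA : ‖A‖ ≤ 1) :
    defect A ∘L defect A = 1 - adjoint A ∘L A :=
  CFC.sqrt_mul_sqrt_self _ (one_sub_adjoint_comp_self_nonneg hA)

theorem adjoint_defect (A : H₁ →L[ℂ] H₂) : adjoint (defect A) = defect A :=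
  (IsSelfAdjoint.of_nonneg (CFC.sqrt_nonneg (1 - adjoint A ∘L A))).adjoint_eq

theorem norm_defect_apply_sq {A : H₁ →L[ℂ] H₂} (hA : ‖A‖ ≤ 1) (x : H₁) :
    ‖defect A x‖ ^ 2 = ‖x‖ ^ 2 - ‖A x‖ ^ 2 := by
  have h : ⟪defect A x, defect A x⟫_ℂ = ⟪x, x⟫_ℂ - ⟪A x, A x⟫_ℂ := by
    rw [← adjoint_inner_right, adjoint_defect, ← comp_apply, defect_comp_defect hA,
      one_sub_adjoint_comp_self_apply, inner_sub_right, adjoint_inner_right]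
  simp only [inner_self_eq_norm_sq_to_K] at h
  exact_mod_cast h

/-- A sufficient condition for Shmul'yan domination which does not involve square roots. -/
theorem shmulyanDominatedBy_of_eq {A B : H₁ →L[ℂ] H₂} (hA : ‖A‖ ≤ 1) (Z : H₁ →L[ℂ] H₂)
    (h : B = A + (1 - A ∘L adjoint A) ∘L Z ∘L (1 - adjoint A ∘L A)) :
    ShmulyanDominatedBy B A := by
  -- With `X = D_{A*} Z D_A`, the outer defect operators are squared, which removes the roots.
  refine ⟨defectInto (adjoint A) ∘L Z ∘L defectFrom A, ?_⟩
  have h1 := defect_comp_defect hA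
  have h2 := defect_comp_defect (A := adjoint A) (by rwa [LinearIsometryEquiv.norm_map])
  rw [adjoint_adjoint] at h2
  rw [h, ← h1, ← h2]
  rfl

theorem IsPartialIsometry.adjoint {T : H₁ →L[ℂ] H₂} (hT : IsPartialIsometry T) :
    IsPartialIsometry (adjoint T) := by
  have h := congrArg ContinuousLinearMap.adjoint hT
  rw [adjoint_comp, adjoint_comp, adjoint_adjoint, comp_assoc] at h
  rwa [IsPartialIsometry, adjoint_adjoint]

theorem IsPartialIsometry.apply {T : H₁ →L[ℂ] H₂} (hT : IsPartialIsometry T) (x : H₁) :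
    T (ContinuousLinearMap.adjoint T (T x)) = T x :=
  congrArg (fun S : H₁ →L[ℂ] H₂ => S x) hT

theorem IsPartialIsometry.adjoint_apply {T : H₁ →L[ℂ] H₂} (hT : IsPartialIsometry T) (y : H₂) :
    ContinuousLinearMap.adjoint T (T (ContinuousLinearMap.adjoint T y)) =
      ContinuousLinearMap.adjoint T y := by
  simpa using hT.adjoint.apply y

/-- The defect operator of a partial isometry is the projection onto its kernel. -/
theorem IsPartialIsometry.defect_eq {T : H₁ →L[ℂ] H₂} (hT : IsPartialIsometry T) :
    defect T = 1 - ContinuousLinearMap.adjoint T ∘L T := by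
  refine CFC.sqrt_unique ?_ (one_sub_adjoint_comp_self_nonneg hT.norm_le_one)
  ext x
  simp [hT.apply]

theorem IsPartialIsometry.defect_apply {T : H₁ →L[ℂ] H₂} (hT : IsPartialIsometry T) (x : H₁) :
    defect T x = x - ContinuousLinearMap.adjoint T (T x) := by
  rw [hT.defect_eq]
  rfl

theorem IsPartialIsometry.defect_adjoint_apply {T : H₁ →L[ℂ] H₂} (hT : IsPartialIsometry T)
    (y : H₂) : defect (ContinuousLinearMap.adjoint T) y =
      y - T (ContinuousLinearMap.adjoint T y) := by
  rw [hT.adjoint.defect_apply, adjoint_adjoint]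

/-- The defect space of a partial isometry is contained in its kernel. -/
theorem IsPartialIsometry.apply_defectSpace {T : H₁ →L[ℂ] H₂} (hT : IsPartialIsometry T)
    (x : defectSpace T) : T x = 0 := by
  have h : defectSpace T ≤ LinearMap.ker T.toLinearMap := by
    refine Submodule.topologicalClosure_minimal _ ?_ T.isClosed_ker
    rintro _ ⟨x, rfl⟩
    simp [hT.defect_apply, hT.apply]
  exact h x.2

theorem IsPartialIsometry.defect_of_mem {T : H₁ →L[ℂ] H₂} (hT : IsPartialIsometry T)
    (x : defectSpace T) : defect T x = x := by
  simp [hT.defect_apply, hT.apply_defectSpace]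

/-- The perturbation takes its values in `𝒟_{T*}`, which lies in `ker T*`. -/
theorem IsPartialIsometry.adjoint_comp_sub_eq_zero {T B : H₁ →L[ℂ] H₂} (hT : IsPartialIsometry T)
    {X : defectSpace T →L[ℂ] defectSpace (ContinuousLinearMap.adjoint T)}
    (h : B = defectPerturbation T X) : ContinuousLinearMap.adjoint T ∘L (B - T) = 0 := by
  ext x
  have h1 := hT.adjoint.apply_defectSpace (X (defectInto T x))
  have h2 := hT.adjoint.defect_of_mem (X (defectInto T x))
  simp [h, defectPerturbation, defectFrom, h1, h2]

/-- Here `D_T T* = T* - T*TT* = 0`. -/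
theorem IsPartialIsometry.sub_comp_adjoint_eq_zero {T B : H₁ →L[ℂ] H₂} (hT : IsPartialIsometry T)
    {X : defectSpace T →L[ℂ] defectSpace (ContinuousLinearMap.adjoint T)}
    (h : B = defectPerturbation T X) : (B - T) ∘L ContinuousLinearMap.adjoint T = 0 := by
  ext y
  have h1 : defectInto T (ContinuousLinearMap.adjoint T y) = 0 := by
    ext
    simp [defectInto, hT.defect_apply, hT.adjoint_apply]
  simp [h, defectPerturbation, h1]

/-- Converse of the two preceding lemmas: the hypotheses make `B - T` invariant under compression by
`1 - TT*` and `1 - T*T`. -/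
theorem IsPartialIsometry.dominates {T B : H₁ →L[ℂ] H₂} (hT : IsPartialIsometry T)
    (h₁ : ContinuousLinearMap.adjoint T ∘L (B - T) = 0)
    (h₂ : (B - T) ∘L ContinuousLinearMap.adjoint T = 0) : ShmulyanDominatedBy B T := by
  refine shmulyanDominatedBy_of_eq hT.norm_le_one (B - T) ?_
  have e₁ : (B - T) ∘L (1 - ContinuousLinearMap.adjoint T ∘L T) = B - T := by
    rw [comp_sub, ← comp_assoc, h₂, zero_comp, sub_zero]
    rfl
  have e₂ : (1 - T ∘L ContinuousLinearMap.adjoint T) ∘L (B - T) = B - T := by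
    rw [sub_comp, comp_assoc, h₁, comp_zero, sub_zero]
    rfl
  rw [e₁, e₂, add_sub_cancel]

/-- An operator `T` is dominated by its contractive perturbation `A` if `A - T` is a strict
contraction that vanishes on the range of `T*` and whose range is orthogonal to that of `T`. -/
theorem shmulyanDominatedBy_of_norm_sub_lt_one {T A : H₁ →L[ℂ] H₂} (hA : ‖A‖ ≤ 1)
    (h₁ : ContinuousLinearMap.adjoint T ∘L (A - T) = 0)
    (h₂ : (A - T) ∘L ContinuousLinearMap.adjoint T = 0) (hlt : ‖A - T‖ < 1) :
    ShmulyanDominatedBy T A := by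
  obtain ⟨B, hB⟩ : ∃ B, B = A - T := ⟨_, rfl⟩
  obtain rfl : A = T + B := by rw [hB]; abel
  rw [add_sub_cancel_left] at h₁ h₂ hlt
  clear hB
  have h₁' : ContinuousLinearMap.adjoint B ∘L T = 0 := by
    simpa [adjoint_comp] using congrArg ContinuousLinearMap.adjoint h₁
  have h₂' : T ∘L ContinuousLinearMap.adjoint B = 0 := by
    simpa [adjoint_comp] using congrArg ContinuousLinearMap.adjoint h₂
  have hlt' : ‖B‖ * ‖B‖ < 1 := by nlinarith [norm_nonneg B]
  have u₁ : IsUnit (1 - ContinuousLinearMap.adjoint B ∘L B) :=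
    isUnit_one_sub_of_norm_lt_one (by rwa [norm_adjoint_comp_self])
  have u₂ : IsUnit (1 - B ∘L ContinuousLinearMap.adjoint B) := by
    refine isUnit_one_sub_of_norm_lt_one ?_
    have := norm_adjoint_comp_self (ContinuousLinearMap.adjoint B)
    rw [adjoint_adjoint, LinearIsometryEquiv.norm_map] at this
    rwa [this]
  obtain ⟨M, hM⟩ := u₁.exists_left_inv
  obtain ⟨N, hN⟩ := u₂.exists_right_inv
  -- All cross terms of `T` and `B` vanish, so `1 - A*A` and `1 - AA*` factor as in `e₁` and `e₂`.
  -- The factors are ordered so that `M` and `N` cancel those with `B`; what is left is `-(1 - TT*)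
  -- B (1 - T*T) = -B`.
  refine shmulyanDominatedBy_of_eq hA (-(N ∘L B ∘L M)) ?_
  have e₁ : 1 - ContinuousLinearMap.adjoint (T + B) ∘L (T + B) =
      (1 - ContinuousLinearMap.adjoint B ∘L B) ∘L (1 - ContinuousLinearMap.adjoint T ∘L T) := by
    ext x
    have a := DFunLike.congr_fun h₁ x
    have b := DFunLike.congr_fun h₁' x
    have c := DFunLike.congr_fun h₂ (T x)
    simp at a b c
    simp [a, b, c]
    abel
  have e₂ : 1 - (T + B) ∘L ContinuousLinearMap.adjoint (T + B) =
      (1 - T ∘L ContinuousLinearMap.adjoint T) ∘L (1 - B ∘L ContinuousLinearMap.adjoint B) := by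
    ext y
    have a := DFunLike.congr_fun h₂ y
    have b := DFunLike.congr_fun h₂' y
    have c := DFunLike.congr_fun h₁ (ContinuousLinearMap.adjoint B y)
    simp at a b c
    simp [a, b, c]
    abel
  have hMx : ∀ x, M ((1 - ContinuousLinearMap.adjoint B ∘L B) x) = x :=
    fun x => DFunLike.congr_fun hM x
  have hNy : ∀ y, (1 - B ∘L ContinuousLinearMap.adjoint B) (N y) = y :=
    fun y => DFunLike.congr_fun hN y
  rw [e₁, e₂]
  ext x
  have c := DFunLike.congr_fun h₂ (T x)
  have d := DFunLike.congr_fun h₁ x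
  simp only [comp_apply, zero_apply] at c d
  simp only [add_apply, comp_apply, neg_apply, map_neg, hMx, hNy]
  simp [c, d]

/-- Writing `T = A + Y D_A`, one has `A x = -Y D_A x` on `ker T`, while `‖D_A x‖² = ‖x‖² - ‖A x‖²`.
Solving the resulting inequality for `‖A x‖` gives the constant. -/
theorem exists_norm_apply_le_of_dominatedBy {T A : H₁ →L[ℂ] H₂} (hA : ‖A‖ ≤ 1)
    (h : ShmulyanDominatedBy T A) :
    ∃ c : ℝ, 0 ≤ c ∧ c < 1 ∧ ∀ x, T x = 0 → ‖A x‖ ≤ c * ‖x‖ := by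
  obtain ⟨X, hX⟩ := h
  obtain ⟨Y, hY⟩ : ∃ Y, Y = defectFrom (adjoint A) ∘L X := ⟨_, rfl⟩
  have hpos : 0 < 1 + ‖Y‖ ^ 2 := by positivity
  refine ⟨√(‖Y‖ ^ 2 / (1 + ‖Y‖ ^ 2)), Real.sqrt_nonneg _, ?_, fun x hx => ?_⟩
  · rw [Real.sqrt_lt' one_pos, div_lt_iff₀ hpos]
    linarith
  · have h1 : A x = -Y (defectInto A x) := by
      rw [hX] at hx
      rw [hY]
      exact eq_neg_of_add_eq_zero_left hx
    have h2 : ‖A x‖ ≤ ‖Y‖ * ‖defect A x‖ := by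
      rw [h1, norm_neg]
      exact Y.le_opNorm _
    have h3 : ‖A x‖ ^ 2 ≤ ‖Y‖ ^ 2 * (‖x‖ ^ 2 - ‖A x‖ ^ 2) := by
      rw [← norm_defect_apply_sq hA, ← mul_pow]
      gcongr
    refine le_of_sq_le_sq ?_ (by positivity)
    rw [mul_pow, Real.sq_sqrt (by positivity), div_mul_eq_mul_div, le_div_iff₀ hpos]
    linarith

end Operators

/-! ### Szegő kernels, Toeplitz operators and their symbols. -/

section Hardy

variable {E E' : Type*} [NormedAddCommGroup E] [InnerProductSpace ℂ E]
  [NormedAddCommGroup E'] [InnerProductSpace ℂ E']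

theorem HardyTwo.eval_zero (z : 𝔻) : (0 : HardyTwo E).eval z = 0 := by
  simp [HardyTwo.eval]

theorem HardyTwo.eval_single_zero (x : E) (z : 𝔻) :
    HardyTwo.eval (lp.single 2 0 x : HardyTwo E) z = x := by
  rw [HardyTwo.eval, tsum_eq_single 0 fun n hn => by rw [lp.single_apply_ne _ _ _ hn, smul_zero],
    lp.single_apply_self, pow_zero, one_smul]

/-- The function `y / (1 - conj z * w)` of `w`, which represents the evaluation at `z`. -/
theorem HardyTwo.exists_kernel (z : 𝔻) (y : E) :
    ∃ k : HardyTwo E, ∀ n, k n = (starRingEnd ℂ (z : ℂ)) ^ n • y := by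
  refine ⟨⟨fun n => (starRingEnd ℂ (z : ℂ)) ^ n • y, memℓp_gen ?_⟩, fun n => rfl⟩
  have hz : ‖(z : ℂ)‖ ^ 2 < 1 := by
    have := z.norm_lt_one
    have := norm_nonneg (z : ℂ)
    nlinarith
  refine ((summable_geometric_of_lt_one (by positivity) hz).mul_right (‖y‖ ^ 2)).congr fun n => ?_
  simp only [norm_smul, norm_pow, RCLike.norm_conj, ENNReal.toReal_ofNat, Real.rpow_ofNat]
  ring

variable [CompleteSpace E] [CompleteSpace E']

theorem HardyTwo.hasSum_eval (g : HardyTwo E) (z : 𝔻) :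
    HasSum (fun n => (z : ℂ) ^ n • g n) (g.eval z) :=
  (summable_norm_pow (coeff_le g) z.norm_lt_one).of_norm.hasSum

theorem HardyTwo.eval_sub (g h : HardyTwo E) (z : 𝔻) :
    (g - h).eval z = g.eval z - h.eval z := by
  rw [eq_sub_iff_add_eq, ← HardyTwo.eval_add, sub_add_cancel]

/-- The Toeplitz operator of a constant function acts coefficientwise. -/
theorem toeplitz_const_apply (T : E →L[ℂ] E') (hT : ‖T‖ ≤ 1) (g : HardyTwo E) (n : ℕ) :
    toeplitz (SchurClass.const T hT) g n = T (g n) := by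
  have hle : ∀ n, ‖T (g n)‖ ≤ ‖g n‖ := fun n => (T.le_of_opNorm_le hT _).trans_eq (one_mul _)
  have hmem : Memℓp (fun n => T (g n)) 2 := by
    refine memℓp_gen ((lp.memℓp g).summable (by norm_num) |>.of_nonneg_of_le
      (fun n => by positivity) fun n => ?_)
    gcongr
    exact hle n
  have h : toeplitz (SchurClass.const T hT) g = ⟨fun n => T (g n), hmem⟩ := by
    refine HardyTwo.eval_injective fun z => ?_
    rw [toeplitz_eval]
    have h1 := (g.hasSum_eval z).mapL T
    simp only [map_smul] at h1
    exact h1.tsum_eq.symm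
  rw [h]

theorem adjoint_toeplitz_const (T : E →L[ℂ] E') (hT : ‖T‖ ≤ 1) (hT' : ‖adjoint T‖ ≤ 1) :
    adjoint (toeplitz (SchurClass.const T hT)) = toeplitz (SchurClass.const (adjoint T) hT') := by
  refine ((eq_adjoint_iff _ _).2 fun g h => ?_).symm
  simp only [lp.inner_eq_tsum, toeplitz_const_apply, adjoint_inner_left]

/-- This makes the operator lemmas above available on `H²` as well as on `E`. -/
theorem IsPartialIsometry.toeplitz {T : E →L[ℂ] E'} (hT : IsPartialIsometry T) :
    IsPartialIsometry (toeplitz (SchurClass.const T hT.norm_le_one)) := by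
  rw [IsPartialIsometry, adjoint_toeplitz_const _ _ hT.adjoint.norm_le_one]
  ext g n
  simp only [comp_apply, toeplitz_const_apply, hT.apply]

/-- The reproducing property of the Szegő kernel. -/
theorem HardyTwo.inner_kernel {z : 𝔻} {y : E} {k : HardyTwo E}
    (hk : ∀ n, k n = (starRingEnd ℂ (z : ℂ)) ^ n • y) (h : HardyTwo E) :
    ⟪k, h⟫_ℂ = ⟪y, h.eval z⟫_ℂ := by
  refine (lp.hasSum_inner k h).unique ?_
  have h1 := (h.hasSum_eval z).mapL (innerSL ℂ y)
  simpa [hk, inner_smul_left] using h1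

theorem HardyTwo.eval_kernel {z : 𝔻} {y : E} {k : HardyTwo E}
    (hk : ∀ n, k n = (starRingEnd ℂ (z : ℂ)) ^ n • y) :
    k.eval z = (((1 - ‖(z : ℂ)‖ ^ 2)⁻¹ : ℝ) : ℂ) • y := by
  have hz : ‖(z : ℂ)‖ ^ 2 < 1 := by
    have := z.norm_lt_one
    have := norm_nonneg (z : ℂ)
    nlinarith
  have h1 := (Complex.hasSum_ofReal.2
    (hasSum_geometric_of_lt_one (by positivity) hz)).smul_const y
  refine (k.hasSum_eval z).unique ?_
  convert h1 using 2 with n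
  rw [hk, smul_smul, ← mul_pow, Complex.mul_conj']
  push_cast
  rfl

theorem HardyTwo.norm_kernel_sq {z : 𝔻} {y : E} {k : HardyTwo E}
    (hk : ∀ n, k n = (starRingEnd ℂ (z : ℂ)) ^ n • y) :
    ‖k‖ ^ 2 = (1 - ‖(z : ℂ)‖ ^ 2)⁻¹ * ‖y‖ ^ 2 := by
  have h := HardyTwo.inner_kernel hk k
  rw [HardyTwo.eval_kernel hk, inner_smul_right, inner_self_eq_norm_sq_to_K,
    inner_self_eq_norm_sq_to_K] at h
  apply Complex.ofReal_injective
  push_cast at h ⊢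
  exact h

/-- A bound of a Toeplitz operator on the functions with values in a subspace is a bound for the
values of its symbol on that subspace. -/
theorem norm_apply_le_of_toeplitz (F : SchurClass E E') {S : Submodule ℂ E} {c : ℝ} (hc : 0 ≤ c)
    (h : ∀ g : HardyTwo E, (∀ n, g n ∈ S) → ‖toeplitz F g‖ ≤ c * ‖g‖) (z : 𝔻) {x : E}
    (hx : x ∈ S) : ‖F.1 z x‖ ≤ c * ‖x‖ := by
  -- With `r = (1 - |z|²)⁻¹`, the pairing `⟪l, T_F k⟫` equals `r ‖F(z)x‖²`, and Cauchy–Schwarz with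
  -- `h` bounds it by `c ‖l‖ ‖k‖ = c r ‖F(z)x‖ ‖x‖`. The function `k` is admissible in `h` since its
  -- coefficients are multiples of `x`.
  obtain ⟨k, hk⟩ := HardyTwo.exists_kernel z x
  obtain ⟨l, hl⟩ := HardyTwo.exists_kernel z (F.1 z x)
  have hz : 0 < (1 - ‖(z : ℂ)‖ ^ 2)⁻¹ := by
    have := z.norm_lt_one
    have := norm_nonneg (z : ℂ)
    exact inv_pos.2 (by nlinarith)
  have hk2 := HardyTwo.norm_kernel_sq hk
  have hl2 := HardyTwo.norm_kernel_sq hl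
  have h1 := HardyTwo.inner_kernel hl (toeplitz F k)
  rw [toeplitz_eval, HardyTwo.eval_kernel hk, map_smul, inner_smul_right,
    inner_self_eq_norm_sq_to_K] at h1
  have h2 : (1 - ‖(z : ℂ)‖ ^ 2)⁻¹ * ‖F.1 z x‖ ^ 2 ≤ ‖l‖ * (c * ‖k‖) := by
    calc (1 - ‖(z : ℂ)‖ ^ 2)⁻¹ * ‖F.1 z x‖ ^ 2 = ‖⟪l, toeplitz F k⟫_ℂ‖ := by
          rw [h1, norm_mul, Complex.norm_real, Real.norm_of_nonneg hz.le, norm_pow]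
          simp
      _ ≤ ‖l‖ * ‖toeplitz F k‖ := norm_inner_le_norm _ _
      _ ≤ ‖l‖ * (c * ‖k‖) := by
          gcongr
          exact h k fun n => by rw [hk]; exact S.smul_mem _ hx
  set r := (1 - ‖(z : ℂ)‖ ^ 2)⁻¹
  have h3 : ‖l‖ * ‖k‖ = r * (‖F.1 z x‖ * ‖x‖) := by
    refine (sq_eq_sq₀ (by positivity) (by positivity)).1 ?_
    rw [mul_pow, hl2, hk2]
    ring
  have h4 : r * (‖F.1 z x‖ * ‖F.1 z x‖) ≤ r * (‖F.1 z x‖ * (c * ‖x‖)) := by nlinarith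
  have h5 := le_of_mul_le_mul_left h4 hz
  rcases (norm_nonneg (F.1 z x)).eq_or_lt with h0 | h0
  · rw [← h0]; positivity
  · exact le_of_mul_le_mul_left h5 h0

/-- The difference of two Toeplitz operators is bounded by the supremum of the difference of their
symbols. -/
theorem norm_toeplitz_sub_le (F G : SchurClass E E') {c : ℝ} (hc : 0 ≤ c)
    (h : ∀ z, ‖F.1 z - G.1 z‖ ≤ c) : ‖toeplitz F - toeplitz G‖ ≤ c := by
  refine opNorm_le_bound _ hc fun g => ?_
  obtain ⟨k, hk⟩ : ∃ k, k = (toeplitz F - toeplitz G) g := ⟨_, rfl⟩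
  rw [← hk]
  have hkz : ∀ z, k.eval z = (F.1 z - G.1 z) (g.eval z) := fun z => by
    rw [hk, sub_apply, HardyTwo.eval_sub, toeplitz_eval, toeplitz_eval, sub_apply]
  -- `F - G` may leave the Schur class, so `k` is compared pointwise with `c g`.
  have hs := sum_coeff_sq_le ((c : ℂ) • g) (fun n => k n)
    (fun z hz => summable_norm_pow (coeff_le k) hz) fun z hz => by
      change ‖k.eval (.mk z hz)‖ ≤ ‖HardyTwo.eval ((c : ℂ) • g) (.mk z hz)‖
      rw [hkz, HardyTwo.eval_smul, norm_smul, Complex.norm_real, Real.norm_of_nonneg hc]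
      exact le_of_opNorm_le _ (h _) _
  rw [norm_smul, Complex.norm_real, Real.norm_of_nonneg hc] at hs
  exact lp.norm_le_of_forall_sum_le (by norm_num) (by positivity) fun s => by simpa using hs s

/-- The composition multiplies values by `K(z)(F(z) - G(z))`, and constant functions take every
value in `E`. -/
theorem toeplitz_comp_sub_eq_zero_iff {E'' : Type*} [NormedAddCommGroup E'']
    [InnerProductSpace ℂ E''] [CompleteSpace E''] (F G : SchurClass E E')
    (K : SchurClass E' E'') :
    toeplitz K ∘L (toeplitz F - toeplitz G) = 0 ↔ ∀ z, K.1 z ∘L (F.1 z - G.1 z) = 0 := by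
  have key : ∀ g z, HardyTwo.eval ((toeplitz K ∘L (toeplitz F - toeplitz G)) g) z =
      (K.1 z ∘L (F.1 z - G.1 z)) (g.eval z) := fun g z => by
    rw [comp_apply, toeplitz_eval, sub_apply, HardyTwo.eval_sub, toeplitz_eval, toeplitz_eval]
    rfl
  refine ⟨fun h z => ?_, fun h => ?_⟩
  · ext x
    have := key (lp.single 2 0 x) z
    rw [h, HardyTwo.eval_single_zero, zero_apply, HardyTwo.eval_zero] at this
    exact this.symm
  · refine ContinuousLinearMap.ext fun g => HardyTwo.eval_injective fun z => ?_
    rw [key, h, zero_apply, zero_apply, HardyTwo.eval_zero]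

theorem toeplitz_sub_comp_eq_zero_iff {E'' : Type*} [NormedAddCommGroup E'']
    [InnerProductSpace ℂ E''] [CompleteSpace E''] (F G : SchurClass E E')
    (K : SchurClass E'' E) :
    (toeplitz F - toeplitz G) ∘L toeplitz K = 0 ↔ ∀ z, (F.1 z - G.1 z) ∘L K.1 z = 0 := by
  have key : ∀ g z, HardyTwo.eval (((toeplitz F - toeplitz G) ∘L toeplitz K) g) z =
      ((F.1 z - G.1 z) ∘L K.1 z) (g.eval z) := fun g z => by
    rw [comp_apply, sub_apply, HardyTwo.eval_sub, toeplitz_eval F, toeplitz_eval G, toeplitz_eval K]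
    rfl
  refine ⟨fun h z => ?_, fun h => ?_⟩
  · ext x
    have := key (lp.single 2 0 x) z
    rw [h, HardyTwo.eval_single_zero, zero_apply, HardyTwo.eval_zero] at this
    exact this.symm
  · refine ContinuousLinearMap.ext fun g => HardyTwo.eval_injective fun z => ?_
    rw [key, h, zero_apply, zero_apply, HardyTwo.eval_zero]

/-- The functions dominated by a constant partial isometry. -/
theorem IsPartialIsometry.dominatedBy_const_iff {T : E →L[ℂ] E'} (hT : IsPartialIsometry T)
    (F : SchurClass E E') : DominatedBy F (SchurClass.const T hT.norm_le_one) ↔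
      ∀ z, ContinuousLinearMap.adjoint T ∘L (F.1 z - T) = 0 ∧
        (F.1 z - T) ∘L ContinuousLinearMap.adjoint T = 0 := by
  have ha := adjoint_toeplitz_const T hT.norm_le_one hT.adjoint.norm_le_one
  have h₁ := toeplitz_comp_sub_eq_zero_iff F (SchurClass.const T hT.norm_le_one)
    (SchurClass.const _ hT.adjoint.norm_le_one)
  have h₂ := toeplitz_sub_comp_eq_zero_iff F (SchurClass.const T hT.norm_le_one)
    (SchurClass.const _ hT.adjoint.norm_le_one)
  -- The Toeplitz operator of the constant `T*` becomes the adjoint of that of `T`.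
  rw [← ha] at h₁ h₂
  rw [forall_and]
  refine (?_ : _ ↔ _).trans (and_congr h₁ h₂)
  exact ⟨fun ⟨_, hX⟩ => ⟨hT.toeplitz.adjoint_comp_sub_eq_zero hX,
    hT.toeplitz.sub_comp_adjoint_eq_zero hX⟩, fun h => hT.toeplitz.dominates h.1 h.2⟩

/-! ### Recovering `F₀` from `F` by compression. -/

/-- The compression of an operator to the defect spaces of a partial isometry. -/
def defectCompression (T : E →L[ℂ] E') (A : E →L[ℂ] E') :
    defectSpace T →L[ℂ] defectSpace (adjoint T) :=
  defectInto (adjoint T) ∘L A ∘L (defectSpace T).subtypeL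

/-- The hypotheses give `A T*T = T` and `T*A = T*T`, hence `D_{T*} A D_T = A - T`. -/
theorem IsPartialIsometry.defectPerturbation_defectCompression {T A : E →L[ℂ] E'}
    (hT : IsPartialIsometry T) (h₁ : ContinuousLinearMap.adjoint T ∘L (A - T) = 0)
    (h₂ : (A - T) ∘L ContinuousLinearMap.adjoint T = 0) :
    defectPerturbation T (defectCompression T A) = A := by
  ext x
  have a := DFunLike.congr_fun h₁ x
  have b := DFunLike.congr_fun h₂ (T x)
  simp only [comp_apply, sub_apply, zero_apply, map_sub, sub_eq_zero, hT.apply] at a b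
  simp [defectPerturbation, defectCompression, defectFrom, defectInto, hT.defect_apply,
    hT.defect_adjoint_apply, hT.apply, a, b]

/-- For `x` in `𝒟_T`, `T*A x = T*T x = 0`, so `D_{T*}` fixes `A x`. -/
theorem IsPartialIsometry.norm_defectCompression_apply {T A : E →L[ℂ] E'}
    (hT : IsPartialIsometry T) (h₁ : ContinuousLinearMap.adjoint T ∘L (A - T) = 0)
    (x : defectSpace T) : ‖defectCompression T A x‖ = ‖A x‖ := by
  have a := DFunLike.congr_fun h₁ (x : E)
  simp only [comp_apply, sub_apply, zero_apply, map_sub, sub_eq_zero, hT.apply_defectSpace,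
    map_zero] at a
  have : ((defectCompression T A x : defectSpace (ContinuousLinearMap.adjoint T)) : E') = A x := by
    simp [defectCompression, defectInto, hT.defect_adjoint_apply, a]
  rw [← this]
  rfl

theorem AnalyticOnDisc.defectCompression {F : 𝔻 → (E →L[ℂ] E')} (hF : AnalyticOnDisc F)
    (T : E →L[ℂ] E') : AnalyticOnDisc fun z => defectCompression T (F z) := by
  obtain ⟨f, hf, hFf⟩ := hF
  refine ⟨fun z => ShmulyanTerHorst.defectCompression T (f z), ?_, fun z => congrArg _ (hFf z)⟩
  exact (differentiableOn_const _).clm_comp (hf.clm_comp (differentiableOn_const _))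

/-- `D_{T*}` is the identity on `𝒟_{T*}` and `D_T` is a contraction. -/
theorem IsPartialIsometry.norm_defectPerturbation_sub_le {T : E →L[ℂ] E'}
    (hT : IsPartialIsometry T)
    (X : defectSpace T →L[ℂ] defectSpace (ContinuousLinearMap.adjoint T)) :
    ‖defectPerturbation T X - T‖ ≤ ‖X‖ := by
  refine opNorm_le_bound _ (norm_nonneg X) fun x => ?_
  have h1 : (defectPerturbation T X - T) x = X (defectInto T x) := by
    simp [defectPerturbation, defectFrom, hT.adjoint.defect_of_mem]
  have h2 : ‖defectInto T x‖ ≤ ‖x‖ := by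
    have h3 := norm_defect_apply_sq hT.norm_le_one x
    have h4 : ‖defectInto T x‖ = ‖defect T x‖ := rfl
    rw [h4]
    exact le_of_sq_le_sq (by nlinarith [sq_nonneg ‖T x‖]) (norm_nonneg x)
  rw [h1]
  exact X.le_opNorm_of_le h2

end Hardy

end ShmulyanTerHorst

end

open ShmulyanTerHorst in
theorem mainTheorem7 {E E' : Type*}
    [NormedAddCommGroup E] [InnerProductSpace ℂ E] [CompleteSpace E]
    [TopologicalSpace.SeparableSpace E]
    [NormedAddCommGroup E'] [InnerProductSpace ℂ E'] [CompleteSpace E']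
    [TopologicalSpace.SeparableSpace E']
    (T : E →L[ℂ] E') (hT : ShmulyanTerHorst.IsPartialIsometry T) :
    ShmulyanTerHorst.equivalenceClass (ShmulyanTerHorst.SchurClass.const T hT.norm_le_one) =
      {F : ShmulyanTerHorst.SchurClass E E' |
        ∃ F₀ : ShmulyanTerHorst.SchurClass (ShmulyanTerHorst.defectSpace T)
            (ShmulyanTerHorst.defectSpace (ContinuousLinearMap.adjoint T)),
          ShmulyanTerHorst.hInfinityNorm F₀.1 < 1 ∧
            ∀ z : Complex.UnitDisc,
              F.1 z = ShmulyanTerHorst.defectPerturbation T (F₀.1 z)} := by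
  ext F
  constructor
  · rintro ⟨hF, hF'⟩
    have h := (hT.dominatedBy_const_iff F).1 hF
    obtain ⟨c, hc0, hc1, hc⟩ := exists_norm_apply_le_of_dominatedBy (norm_toeplitz_le F) hF'
    have hbd : ∀ z, ‖defectCompression T (F.1 z)‖ ≤ c := fun z =>
      ContinuousLinearMap.opNorm_le_bound _ hc0 fun x => by
        rw [hT.norm_defectCompression_apply (h z).1]
        -- Functions with coefficients in `𝒟_T` lie in the kernel of `T_T`, where the bound `c`
        -- applies.
        refine norm_apply_le_of_toeplitz F hc0 (fun g hg => hc g ?_) z x.2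
        ext n
        rw [toeplitz_const_apply]
        exact hT.apply_defectSpace ⟨g n, hg n⟩
    have hsup : hInfinityNorm (fun z => defectCompression T (F.1 z)) ≤ c := ciSup_le hbd
    exact ⟨⟨fun z => defectCompression T (F.1 z),
      ⟨F.2.1.1.defectCompression T, c, Set.forall_mem_range.2 hbd⟩, hsup.trans hc1.le⟩,
      hsup.trans_lt hc1,
      fun z => (hT.defectPerturbation_defectCompression (h z).1 (h z).2).symm⟩
  · rintro ⟨F₀, hF₀, hF⟩
    have hdom := (hT.dominatedBy_const_iff F).2 fun z =>
      ⟨hT.adjoint_comp_sub_eq_zero (hF z), hT.sub_comp_adjoint_eq_zero (hF z)⟩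
    refine ⟨hdom, ?_⟩
    obtain ⟨X, hX⟩ := hdom
    -- It remains to see that `‖T_F - T_T‖ ≤ sup ‖F(z) - T‖ ≤ ‖F₀‖_∞ < 1`.
    refine shmulyanDominatedBy_of_norm_sub_lt_one (norm_toeplitz_le F)
      (hT.toeplitz.adjoint_comp_sub_eq_zero hX) (hT.toeplitz.sub_comp_adjoint_eq_zero hX) ?_
    refine (norm_toeplitz_sub_le _ _ (Real.iSup_nonneg fun z => norm_nonneg (F₀.1 z))
      fun z => ?_).trans_lt hF₀
    rw [hF]
    exact (hT.norm_defectPerturbation_sub_le _).trans (le_ciSup F₀.2.1.2 z)
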